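/- Let $\mathbb{Q}\langle a,b\rangle$ be the algebra of polynomials in the noncommuting variables $a,b$, with coproduct $\Delta(u_1\cdots u_m)=\sum_{t=1}^m u_1\cdots u_{t-1}\otimes u_{t+1}\cdots u_m=\sum_u u_{(1)}\otimes u_{(2)}$ on $ab$-words. The mixing operator $M$ is the bilinear operator on $\mathbb{Q}\langle a,b\rangle$ given on pairs of $ab$-words $(u,v)$ by $$M(u,v)=\sum_{r=1}^2\sum_{s=1}^2\ \sum_{n\ge 2,\ n-r-s-1\text{ even}} M_{r,s,n}(u,v),$$ where $M_{1,2,2}(u,v)=u\,a\,v$, $M_{2,1,2}(u,v)=v\,b\,u$, and for $n\ge 2$ $$M_{1,s,n+1}(u,v)=\sum_u u_{(1)}\,a\,M_{2,s,n}(u_{(2)},v),\qquad M_{2,s,n+1}(u,v)=\sum_v v_{(1)}\,b\,M_{1,s,n}(u,v_{(2)})$$ (with $M_{1,1,2}=M_{2,2,2}=0$). Put $c=a+b$, $d=ab+ba$ and $e=a-b$, so that $e^2=c^2-2d$. Theorem. Let $i,j\ge 0$ be integers. Then $M(c^i,c^j)$ can be written in exactly one way as a polynomial with rational coefficients in the noncommuting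 expressions $c$ and $e^2$ (its $ce$-index), and for all integers $r\ge 0$ and $k_0,\dots,k_r\ge 0$ the coefficient of $c^{k_0}e^2c^{k_1}e^2\cdots e^2c^{k_r}$ in it is $$\frac{(-1)^r}{2}\binom{i+j+2-2r}{i+1-r}\quad\text{if } k_0+k_1+\cdots+k_r+2r=i+j+1,$$ and $0$ otherwise. Here a binomial coefficient $\binom{n}{m}$ with $m<0$ or $m>n$ is $0$. -/

import Mathlib

namespace MixingCE

/-- The two noncommuting letters `a`, `b`. -/
inductive AB : Type
  | a
  | b

/-- The two letters of `ce`-words: `c` and `e2`, the latter standing for the factor `e²`. -/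
inductive CE : Type
  | c
  | e2

/-- The noncommutative polynomial algebra `ℚ⟨X⟩`: the monoid algebra of the free monoid of
words in the alphabet `X`. -/
abbrev NCPoly (X : Type) : Type := MonoidAlgebra ℚ (FreeMonoid X)

/-- A word, given as the list of its letters, as a noncommutative monomial. -/
noncomputable def word {X : Type} (w : List X) : NCPoly X :=
  MonoidAlgebra.of ℚ (FreeMonoid X) (FreeMonoid.ofList w)

/-- The operators `M_{r,s,n}(u,v)` on pairs of `ab`-words, for `r, s ∈ {1, 2}` and `n ≥ 2`:
`M_{1,2,2}(u,v) = u a v`, `M_{2,1,2}(u,v) = v b u`,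
`M_{1,s,n+1}(u,v) = ∑_u u₍₁₎ a M_{2,s,n}(u₍₂₎,v)` and
`M_{2,s,n+1}(u,v) = ∑_v v₍₁₎ b M_{1,s,n}(u,v₍₂₎)`.
Here `∑_u` is Sweedler notation for the coproduct
`Δ(u₁⋯u_m) = ∑_{t=1}^{m} u₁⋯u_{t-1} ⊗ u_{t+1}⋯u_m`.
The remaining values of `r, s, n` are given the value `0`. -/
noncomputable def mixTerm (s : ℕ) : (n r : ℕ) → (u v : List AB) → NCPoly AB
  | 0, _, _, _ => 0
  | 1, _, _, _ => 0
  | 2, r, u, v =>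
      if r = 1 ∧ s = 2 then word u * word [AB.a] * word v
      else if r = 2 ∧ s = 1 then word v * word [AB.b] * word u
      else 0
  | n + 3, r, u, v =>
      if r = 1 then
        ∑ t ∈ Finset.range u.length,
          word (u.take t) * word [AB.a] * mixTerm s (n + 2) 2 (u.drop (t + 1)) v
      else if r = 2 then
        ∑ t ∈ Finset.range v.length,
          word (v.take t) * word [AB.b] * mixTerm s (n + 2) 1 u (v.drop (t + 1))
      else 0

/-- `M_{r,s,n}(u,v)` vanishes once `n` exceeds `|u| + |v| + 2`. -/
theorem mixTerm_eq_zero (s : ℕ) : ∀ (n r : ℕ) (u v : List AB),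
    u.length + v.length + 2 < n → mixTerm s n r u v = 0
  | 0, _, _, _, h => by omega
  | 1, _, _, _, h => by omega
  | 2, _, _, _, h => by omega
  | n + 3, r, u, v, h => by
      rw [mixTerm]
      split_ifs
      · refine Finset.sum_eq_zero fun t ht => ?_
        rw [mixTerm_eq_zero s (n + 2) 2 _ _ ?_, mul_zero]
        have := Finset.mem_range.1 ht
        rw [List.length_drop]
        omega
      · refine Finset.sum_eq_zero fun t ht => ?_
        rw [mixTerm_eq_zero s (n + 2) 1 _ _ ?_, mul_zero]
        have := Finset.mem_range.1 ht
        rw [List.length_drop]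
        omega
      · rfl

/-- The mixing operator on a pair of `ab`-words: the sum of all `M_{r,s,n}(u,v)` with
`r, s ∈ {1, 2}`, `n ≥ 2` and `n - r - s - 1` even. By `mixTerm_eq_zero`, only the
`n ≤ |u| + |v| + 2` contribute. -/
noncomputable def mixWord (u v : List AB) : NCPoly AB :=
  ∑ r ∈ Finset.Icc (1 : ℕ) 2, ∑ s ∈ Finset.Icc (1 : ℕ) 2,
    ∑ n ∈ (Finset.Icc 2 (u.length + v.length + 2)).filter
        (fun n : ℕ => Even ((n : ℤ) - r - s - 1)),
      mixTerm s n r u v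

/-- The mixing operator `M`, the bilinear extension of `mixWord` to `ℚ⟨a,b⟩`. -/
noncomputable def mixing : NCPoly AB →ₗ[ℚ] NCPoly AB →ₗ[ℚ] NCPoly AB :=
  (Finsupp.linearCombination ℚ fun u : FreeMonoid AB =>
    (Finsupp.linearCombination ℚ fun v : FreeMonoid AB =>
      mixWord (FreeMonoid.toList u) (FreeMonoid.toList v)) ∘ₗ
        (MonoidAlgebra.coeffLinearEquiv ℚ).toLinearMap) ∘ₗ
    (MonoidAlgebra.coeffLinearEquiv ℚ).toLinearMap

/-- `c = a + b`. -/
noncomputable def c : NCPoly AB := word [AB.a] + word [AB.b]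

/-- `d = ab + ba`. -/
noncomputable def d : NCPoly AB := word [AB.a] * word [AB.b] + word [AB.b] * word [AB.a]

/-- `e = a - b`. -/
noncomputable def e : NCPoly AB := word [AB.a] - word [AB.b]

theorem e_sq : e ^ 2 = c ^ 2 - 2 * d := by
  unfold e c d
  noncomm_ring

/-- Substitution of `c = a + b` and `e² = (a - b)²` into a `ce`-polynomial. -/
noncomputable def evalCE : NCPoly CE →ₐ[ℚ] NCPoly AB :=
  MonoidAlgebra.lift ℚ (NCPoly AB) (FreeMonoid CE)
    (FreeMonoid.lift fun x => match x with
      | CE.c => c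
      | CE.e2 => e ^ 2)

/-- The word `c^{k₀} e² c^{k₁} e² ⋯ e² c^{k_r}`. -/
def ceWord (r : ℕ) (k : Fin (r + 1) → ℕ) : FreeMonoid CE :=
  FreeMonoid.of CE.c ^ k 0 *
    (List.ofFn fun t : Fin r => FreeMonoid.of CE.e2 * FreeMonoid.of CE.c ^ k t.succ).prod

/-- The binomial coefficient `n` choose `m`, with the value `0` for negative `m`. -/
def binom (n : ℕ) (m : ℤ) : ℕ := if 0 ≤ m then n.choose m.toNat else 0

end MixingCE

namespace MixingCE

/-! Write `M = F₁ + F₂`, with `F_r` collecting all `M_{r,s,n}`; the parity condition only discards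
zero terms. Splitting off a first letter `x` gives `F₁(xp,q) = x F₁(p,q) + a F₂(p,q)` and `F₂(p,xq)
= x F₂(p,q) + b F₁(p,q)`. Summing over `x = a, b` and eliminating `F₁`, `F₂` yields
`mixing_pow_succ_succ`, a recursion whose only multipliers are `c` and `e²`, so it lifts to
`ce`-polynomials (`ceIndex`, `evalCE_ceIndex`).

There, the first letter of a word selects one branch: `c` gives Pascal's rule and `e²` a sign and an
index shift. Hence coefficients depend only on the degree and the number of factors `e²`
(`coeff_ceIndex`). Uniqueness holds because `c` and `e` are themselves free generators
(`evalCE_injective`). -/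

/-- The bilinear extension to `ℚ⟨a,b⟩` of a function of pairs of words. -/
noncomputable def bilExt (F : List AB → List AB → NCPoly AB) :
    NCPoly AB →ₗ[ℚ] NCPoly AB →ₗ[ℚ] NCPoly AB :=
  (Finsupp.linearCombination ℚ fun u : FreeMonoid AB =>
    (Finsupp.linearCombination ℚ fun v : FreeMonoid AB =>
      F (FreeMonoid.toList u) (FreeMonoid.toList v)) ∘ₗ
        (MonoidAlgebra.coeffLinearEquiv ℚ).toLinearMap) ∘ₗ
    (MonoidAlgebra.coeffLinearEquiv ℚ).toLinearMap

theorem word_nil {X : Type} : word ([] : List X) = 1 := rfl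

theorem word_cons {X : Type} (x : X) (w : List X) : word (x :: w) = word [x] * word w := by
  unfold word
  rw [← map_mul]
  rfl

theorem bilExt_word (F : List AB → List AB → NCPoly AB) (u v : List AB) :
    bilExt F (word u) (word v) = F u v := by
  simp [bilExt, word, MonoidAlgebra.of_apply, MonoidAlgebra.coeffLinearEquiv]

/-- Linear maps agreeing on words agree. -/
theorem linearMap_ext_word {X : Type} {V : Type*} [AddCommMonoid V] [Module ℚ V]
    {f g : NCPoly X →ₗ[ℚ] V} (h : ∀ w, f (word w) = g (word w)) : f = g := by
  refine LinearMap.ext fun p => ?_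
  induction p using MonoidAlgebra.induction_linear with
  | zero => simp
  | add p q hp hq => rw [map_add, map_add, hp, hq]
  | single m r =>
    have : MonoidAlgebra.single m r = r • word (FreeMonoid.toList m) := by
      simp [word, MonoidAlgebra.of_apply, MonoidAlgebra.smul_single]
    rw [this, map_smul, map_smul, h]

/-- Both base terms satisfy the parity condition, and each recursion step changes `n - r` by 0 or 2.
-/
theorem mixTerm_eq_zero_of_odd {s : ℕ} (hs : s = 1 ∨ s = 2) :
    ∀ (n r : ℕ) (u v : List AB), r = 1 ∨ r = 2 → ¬ Even ((n : ℤ) - r - s - 1) →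
      mixTerm s n r u v = 0
  | 0, _, _, _, _, _ => rfl
  | 1, _, _, _, _, _ => rfl
  | 2, r, u, v, hr, h => by
    rw [mixTerm]
    split_ifs with h₁ h₂
    · obtain ⟨rfl, rfl⟩ := h₁
      exact absurd (by decide) h
    · obtain ⟨rfl, rfl⟩ := h₂
      exact absurd (by decide) h
    · rfl
  | n + 3, r, u, v, hr, h => by
    rw [mixTerm]
    split_ifs with h₁ h₂
    · subst h₁
      refine Finset.sum_eq_zero fun t _ => ?_
      rw [mixTerm_eq_zero_of_odd hs (n + 2) 2 _ _ (Or.inr rfl), mul_zero]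
      contrapose! h
      obtain ⟨k, hk⟩ := h
      exact ⟨k + 1, by push_cast at hk ⊢; linarith⟩
    · subst h₂
      refine Finset.sum_eq_zero fun t _ => ?_
      rw [mixTerm_eq_zero_of_odd hs (n + 2) 1 _ _ (Or.inl rfl), mul_zero]
      contrapose! h
      obtain ⟨k, hk⟩ := h
      exact ⟨k, by push_cast at hk ⊢; linarith⟩
    · rfl

/-- The sum of the `M_{r,s,n}(u,v)` with `s ∈ {1, 2}` and `2 ≤ n < N + 2`. -/
noncomputable def mixSum (N r : ℕ) (u v : List AB) : NCPoly AB :=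
  ∑ n ∈ Finset.range N, (mixTerm 1 (n + 2) r u v + mixTerm 2 (n + 2) r u v)

/-- The sum of all `M_{r,s,n}(u,v)` with `s ∈ {1, 2}` and `n ≥ 2`. -/
noncomputable def mixFrom (r : ℕ) (u v : List AB) : NCPoly AB :=
  mixSum (u.length + v.length + 1) r u v

theorem mixSum_eq_mixFrom {N r : ℕ} {u v : List AB} (h : u.length + v.length + 1 ≤ N) :
    mixSum N r u v = mixFrom r u v := by
  refine (Finset.sum_subset (Finset.range_mono h) fun n _ hn => ?_).symm
  have : u.length + v.length + 2 < n + 2 := by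
    rw [Finset.mem_range] at hn
    omega
  rw [mixTerm_eq_zero _ _ _ _ _ this, mixTerm_eq_zero _ _ _ _ _ this, add_zero]

theorem mixWord_eq (u v : List AB) : mixWord u v = mixFrom 1 u v + mixFrom 2 u v := by
  have key : ∀ r s : ℕ, r = 1 ∨ r = 2 → s = 1 ∨ s = 2 →
      ∑ n ∈ (Finset.Icc 2 (u.length + v.length + 2)).filter
        (fun n : ℕ => Even ((n : ℤ) - r - s - 1)), mixTerm s n r u v =
      ∑ n ∈ Finset.range (u.length + v.length + 1), mixTerm s (n + 2) r u v := by
    intro r s hr hs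
    rw [Finset.sum_filter_of_ne, Finset.range_eq_Ico,
      Finset.sum_Ico_add' (fun n => mixTerm s n r u v)]
    · rfl
    · intro n _ hn
      by_contra h
      exact hn (mixTerm_eq_zero_of_odd hs n r u v hr h)
  have h12 : Finset.Icc (1 : ℕ) 2 = {1, 2} := rfl
  rw [mixWord, h12, Finset.sum_pair (by decide), Finset.sum_pair (by decide),
    Finset.sum_pair (by decide), key 1 1 (by simp) (by simp), key 1 2 (by simp) (by simp),
    key 2 1 (by simp) (by simp), key 2 2 (by simp) (by simp)]
  simp only [mixFrom, mixSum, Finset.sum_add_distrib]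

/-! ### First-letter recursions for the mixing operator -/

/-- The coproduct either deletes the leading letter `x`, leaving `a` in front, or deletes a later
one, leaving `x` in front. -/
theorem mixTerm_one_cons (s n : ℕ) (x : AB) (u v : List AB) :
    mixTerm s (n + 3) 1 (x :: u) v =
      word [x] * mixTerm s (n + 3) 1 u v + word [AB.a] * mixTerm s (n + 2) 2 u v := by
  rw [mixTerm, mixTerm, if_pos rfl, if_pos rfl, List.length_cons, Finset.sum_range_succ',
    Finset.mul_sum]
  simp only [List.take_succ_cons, List.drop_succ_cons, List.take_zero, List.drop_zero, word_nil,
    one_mul, word_cons x (List.take _ u), mul_assoc]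

theorem mixTerm_two_cons (s n : ℕ) (x : AB) (u v : List AB) :
    mixTerm s (n + 3) 2 u (x :: v) =
      word [x] * mixTerm s (n + 3) 2 u v + word [AB.b] * mixTerm s (n + 2) 1 u v := by
  rw [mixTerm, mixTerm, if_neg (by decide), if_pos rfl, if_neg (by decide), if_pos rfl,
    List.length_cons, Finset.sum_range_succ', Finset.mul_sum]
  simp only [List.take_succ_cons, List.drop_succ_cons, List.take_zero, List.drop_zero, word_nil,
    one_mul, word_cons x (List.take _ v), mul_assoc]

theorem mixTerm_one_nil (s n : ℕ) (v : List AB) : mixTerm s (n + 3) 1 [] v = 0 := by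
  simp [mixTerm]

theorem mixTerm_two_nil (s n : ℕ) (u : List AB) : mixTerm s (n + 3) 2 u [] = 0 := by
  simp [mixTerm]

theorem mixFrom_one_nil (v : List AB) : mixFrom 1 [] v = word [AB.a] * word v := by
  rw [mixFrom, mixSum, Finset.sum_range_succ', Finset.sum_eq_zero]
  · simp [mixTerm, word_nil]
  · intro n _
    rw [mixTerm_one_nil, mixTerm_one_nil, add_zero]

theorem mixFrom_two_nil (u : List AB) : mixFrom 2 u [] = word [AB.b] * word u := by
  rw [mixFrom, mixSum, Finset.sum_range_succ', Finset.sum_eq_zero]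
  · simp [mixTerm, word_nil]
  · intro n _
    rw [mixTerm_two_nil, mixTerm_two_nil, add_zero]

theorem mixFrom_one_cons (x : AB) (u v : List AB) :
    mixFrom 1 (x :: u) v = word [x] * mixFrom 1 u v + word [AB.a] * mixFrom 2 u v := by
  -- The cutoff for `u` is raised by one to match that for `x :: u`; the `F₂` sum keeps the lower
  -- cutoff, since its index `n` lags by one.
  rw [mixFrom, ← mixSum_eq_mixFrom (N := u.length + v.length + 1 + 1) (Nat.le_succ _),
    mixFrom, List.length_cons,
    show u.length + 1 + v.length + 1 = u.length + v.length + 1 + 1 by ring]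
  generalize u.length + v.length + 1 = N
  simp only [mixSum]
  rw [Finset.sum_range_succ', Finset.sum_range_succ' _ N, mul_add,
    Finset.mul_sum, Finset.mul_sum, add_right_comm, ← Finset.sum_add_distrib]
  congr 1
  · refine Finset.sum_congr rfl fun n _ => ?_
    rw [mixTerm_one_cons, mixTerm_one_cons]
    noncomm_ring
  · simp [mixTerm, word_cons x u, mul_assoc]

theorem mixFrom_two_cons (x : AB) (u v : List AB) :
    mixFrom 2 u (x :: v) = word [x] * mixFrom 2 u v + word [AB.b] * mixFrom 1 u v := by
  rw [mixFrom, ← mixSum_eq_mixFrom (N := u.length + v.length + 1 + 1) (Nat.le_succ _),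
    mixFrom, List.length_cons, ← add_assoc]
  generalize u.length + v.length + 1 = N
  simp only [mixSum]
  rw [Finset.sum_range_succ', Finset.sum_range_succ' _ N, mul_add,
    Finset.mul_sum, Finset.mul_sum, add_right_comm, ← Finset.sum_add_distrib]
  congr 1
  · refine Finset.sum_congr rfl fun n _ => ?_
    rw [mixTerm_two_cons, mixTerm_two_cons]
    noncomm_ring
  · simp [mixTerm, word_cons x v, mul_assoc]

theorem mixing_eq : mixing = bilExt (mixFrom 1) + bilExt (mixFrom 2) := by
  refine linearMap_ext_word fun u => linearMap_ext_word fun v => ?_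
  rw [LinearMap.add_apply, LinearMap.add_apply, bilExt_word, bilExt_word, ← mixWord_eq]
  exact bilExt_word mixWord u v

theorem bilExt_one_one_left (q : NCPoly AB) :
    bilExt (mixFrom 1) 1 q = word [AB.a] * q := by
  have : bilExt (mixFrom 1) 1 = LinearMap.mulLeft ℚ (word [AB.a]) :=
    linearMap_ext_word fun v => by
      rw [← word_nil, bilExt_word, mixFrom_one_nil, LinearMap.mulLeft_apply]
  rw [this, LinearMap.mulLeft_apply]

theorem bilExt_two_one_right (p : NCPoly AB) :
    bilExt (mixFrom 2) p 1 = word [AB.b] * p := by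
  have : (bilExt (mixFrom 2)).flip 1 = LinearMap.mulLeft ℚ (word [AB.b]) :=
    linearMap_ext_word fun v => by
      rw [LinearMap.flip_apply, ← word_nil, bilExt_word, mixFrom_two_nil, LinearMap.mulLeft_apply]
  rw [← LinearMap.flip_apply, this, LinearMap.mulLeft_apply]

theorem bilExt_one_letter_mul (x : AB) (p q : NCPoly AB) :
    bilExt (mixFrom 1) (word [x] * p) q =
      word [x] * bilExt (mixFrom 1) p q + word [AB.a] * bilExt (mixFrom 2) p q := by
  have : bilExt (mixFrom 1) ∘ₗ LinearMap.mulLeft ℚ (word [x]) =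
      (bilExt (mixFrom 1)).compr₂ (LinearMap.mulLeft ℚ (word [x])) +
        (bilExt (mixFrom 2)).compr₂ (LinearMap.mulLeft ℚ (word [AB.a])) :=
    linearMap_ext_word fun u => linearMap_ext_word fun v => by
      simp [← word_cons, bilExt_word, mixFrom_one_cons]
  simpa using congr($this p q)

theorem bilExt_two_letter_mul (x : AB) (p q : NCPoly AB) :
    bilExt (mixFrom 2) p (word [x] * q) =
      word [x] * bilExt (mixFrom 2) p q + word [AB.b] * bilExt (mixFrom 1) p q := by
  have : (bilExt (mixFrom 2)).compl₂ (LinearMap.mulLeft ℚ (word [x])) =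
      (bilExt (mixFrom 2)).compr₂ (LinearMap.mulLeft ℚ (word [x])) +
        (bilExt (mixFrom 1)).compr₂ (LinearMap.mulLeft ℚ (word [AB.b])) :=
    linearMap_ext_word fun u => linearMap_ext_word fun v => by
      simp [← word_cons, bilExt_word, mixFrom_two_cons]
  simpa using congr($this p q)

/-- The correction term does not depend on the deleted letter, so the two letters of `c` contribute
it twice. -/
theorem bilExt_one_c_mul (p q : NCPoly AB) :
    bilExt (mixFrom 1) (c * p) q =
      c * bilExt (mixFrom 1) p q + 2 * (word [AB.a] * bilExt (mixFrom 2) p q) := by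
  rw [c, add_mul, map_add, LinearMap.add_apply, bilExt_one_letter_mul, bilExt_one_letter_mul]
  noncomm_ring

theorem bilExt_two_c_mul (p q : NCPoly AB) :
    bilExt (mixFrom 2) p (c * q) =
      c * bilExt (mixFrom 2) p q + 2 * (word [AB.b] * bilExt (mixFrom 1) p q) := by
  rw [c, add_mul, map_add, bilExt_two_letter_mul, bilExt_two_letter_mul]
  noncomm_ring

/-- Expanding both sides down to `F₁(cⁱ,cʲ)` and `F₂(cⁱ,cʲ)` leaves the identity `c² - e² = 2(ab +
ba)`. -/
theorem mixing_pow_succ_succ (i j : ℕ) :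
    mixing (c ^ (i + 1)) (c ^ (j + 1)) =
      c * (mixing (c ^ i) (c ^ (j + 1)) + mixing (c ^ (i + 1)) (c ^ j)) -
        e ^ 2 * mixing (c ^ i) (c ^ j) := by
  simp only [mixing_eq, LinearMap.add_apply, pow_succ' c, bilExt_one_c_mul, bilExt_two_c_mul]
  rw [c, e]
  noncomm_ring

theorem mixing_one_one : mixing 1 1 = c := by
  rw [mixing_eq, LinearMap.add_apply, LinearMap.add_apply, bilExt_one_one_left,
    bilExt_two_one_right, mul_one, mul_one, c]

/-- This is the general recursion with `cʲ / 2` in the role of `M(c⁻¹, cʲ)`, cleared of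
denominators. -/
theorem two_mul_mixing_one_pow_succ (j : ℕ) :
    2 * mixing 1 (c ^ (j + 1)) = c * (c ^ (j + 1) + 2 * mixing 1 (c ^ j)) - e ^ 2 * c ^ j := by
  simp only [mixing_eq, LinearMap.add_apply, pow_succ' c, bilExt_one_one_left, bilExt_two_c_mul]
  generalize c ^ j = q
  rw [c, e]
  noncomm_ring

theorem two_mul_mixing_pow_succ_one (i : ℕ) :
    2 * mixing (c ^ (i + 1)) 1 = c * (2 * mixing (c ^ i) 1 + c ^ (i + 1)) - e ^ 2 * c ^ i := by
  simp only [mixing_eq, LinearMap.add_apply, pow_succ' c, bilExt_two_one_right, bilExt_one_c_mul]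
  generalize c ^ i = q
  rw [c, e]
  noncomm_ring

/-! ### Uniqueness of the `ce`-index -/

/-- The algebra endomorphism of `ℚ⟨a,b⟩` with `a ↦ (a + b) / 2` and `b ↦ (a - b) / 2`. -/
noncomputable def halfSumDiff : NCPoly AB →ₐ[ℚ] NCPoly AB :=
  MonoidAlgebra.lift ℚ (NCPoly AB) (FreeMonoid AB)
    (FreeMonoid.lift fun x => match x with
      | AB.a => (2⁻¹ : ℚ) • (word [AB.a] + word [AB.b])
      | AB.b => (2⁻¹ : ℚ) • (word [AB.a] - word [AB.b]))

theorem halfSumDiff_a :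
    halfSumDiff (word [AB.a]) = (2⁻¹ : ℚ) • (word [AB.a] + word [AB.b]) :=
  (MonoidAlgebra.lift_of _ _).trans (FreeMonoid.lift_eval_of _ _)

theorem halfSumDiff_b :
    halfSumDiff (word [AB.b]) = (2⁻¹ : ℚ) • (word [AB.a] - word [AB.b]) :=
  (MonoidAlgebra.lift_of _ _).trans (FreeMonoid.lift_eval_of _ _)

theorem halfSumDiff_c : halfSumDiff c = word [AB.a] := by
  rw [c, map_add, halfSumDiff_a, halfSumDiff_b]
  module

theorem halfSumDiff_e : halfSumDiff e = word [AB.b] := by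
  rw [e, map_sub, halfSumDiff_a, halfSumDiff_b]
  module

theorem evalCE_c : evalCE (word [CE.c]) = c := by
  rw [evalCE, word, MonoidAlgebra.lift_of, FreeMonoid.ofList_singleton, FreeMonoid.lift_eval_of]

theorem evalCE_e2 : evalCE (word [CE.e2]) = e ^ 2 := by
  rw [evalCE, word, MonoidAlgebra.lift_of, FreeMonoid.ofList_singleton, FreeMonoid.lift_eval_of]

/-- The encoding of `ce`-words as words in two letters with `c ↦ a` and `e² ↦ bb`. -/
def encode : FreeMonoid CE →* FreeMonoid AB :=
  FreeMonoid.lift fun x => match x with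
    | CE.c => FreeMonoid.of AB.a
    | CE.e2 => FreeMonoid.of AB.b * FreeMonoid.of AB.b

theorem encode_injective : Function.Injective encode := by
  have key : ∀ u v : List CE,
      encode (FreeMonoid.ofList u) = encode (FreeMonoid.ofList v) → u = v := by
    have hc : ∀ w, (encode (FreeMonoid.ofList (CE.c :: w))).toList =
        AB.a :: (encode (FreeMonoid.ofList w)).toList := fun w => by
      rw [FreeMonoid.ofList_cons, map_mul]
      rfl
    have he : ∀ w, (encode (FreeMonoid.ofList (CE.e2 :: w))).toList =
        AB.b :: AB.b :: (encode (FreeMonoid.ofList w)).toList := fun w => by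
      rw [FreeMonoid.ofList_cons, map_mul]
      rfl
    have h1 : (encode (FreeMonoid.ofList [])).toList = [] := rfl
    intro u
    induction u with
    | nil =>
      rintro (_ | ⟨_ | _, v⟩) h <;> replace h := congrArg FreeMonoid.toList h
      · rfl
      · rw [h1, hc] at h; cases h
      · rw [h1, he] at h; cases h
    | cons x u ih =>
      rintro (_ | ⟨y, v⟩) h <;> replace h := congrArg FreeMonoid.toList h
      · cases x
        · rw [h1, hc] at h; cases h
        · rw [h1, he] at h; cases h
      · cases x <;> cases y <;>
          simp only [hc, he, List.cons.injEq, true_and, reduceCtorEq, false_and] at h <;>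
          rw [ih v (FreeMonoid.toList.injective h)]
  exact fun u v h => FreeMonoid.toList.injective (key _ _ h)

/-- After the change of variables `c ↦ a`, `e ↦ b`, evaluation sends distinct `ce`-words to distinct
`ab`-words, because `a` and `bb` form a prefix code. -/
theorem evalCE_injective : Function.Injective evalCE := by
  have h : halfSumDiff.comp evalCE = MonoidAlgebra.mapDomainAlgHom ℚ ℚ encode := by
    refine MonoidAlgebra.algHom_ext' ?_ (by ext)
    refine FreeMonoid.hom_eq fun x => ?_
    change halfSumDiff (evalCE (word [x])) = MonoidAlgebra.mapDomain encode (word [x])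
    rw [show MonoidAlgebra.mapDomain encode (word [x]) = word (encode (FreeMonoid.of x)).toList from
      MonoidAlgebra.mapDomain_single]
    cases x
    · rw [evalCE_c, halfSumDiff_c]
      rfl
    · rw [evalCE_e2, map_pow, halfSumDiff_e, sq, ← word_cons]
      rfl
  have h' : Function.Injective (halfSumDiff ∘ evalCE) := by
    rw [← AlgHom.coe_comp, h]
    exact MonoidAlgebra.mapDomain_injective encode_injective
  exact h'.of_comp

/-! ### The recursion for the `ce`-index -/

/-- The `ce`-polynomials defined by the recursion of `mixing_pow_succ_succ`, with indices shifted
by one. -/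
noncomputable def ceIndex : ℕ → ℕ → NCPoly CE
  | 0, 0 => 0
  | 0, j + 1 => (2⁻¹ : ℚ) • word [CE.c] ^ j
  | i + 1, 0 => (2⁻¹ : ℚ) • word [CE.c] ^ i
  | i + 1, j + 1 =>
    word [CE.c] * (ceIndex i (j + 1) + ceIndex (i + 1) j) - word [CE.e2] * ceIndex i j

theorem eq_half_smul {x y : NCPoly AB} (h : 2 * x = y) : x = (2⁻¹ : ℚ) • y := by
  rw [← h, two_mul]
  module

theorem evalCE_half_smul_c_pow (n : ℕ) :
    evalCE ((2⁻¹ : ℚ) • word [CE.c] ^ n) = (2⁻¹ : ℚ) • c ^ n := by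
  rw [map_smul, map_pow, evalCE_c]

theorem evalCE_ceIndex_succ_succ (i j : ℕ) :
    evalCE (ceIndex (i + 1) (j + 1)) =
      c * (evalCE (ceIndex i (j + 1)) + evalCE (ceIndex (i + 1) j)) -
        e ^ 2 * evalCE (ceIndex i j) := by
  rw [ceIndex, map_sub, map_mul, map_mul, map_add, evalCE_c, evalCE_e2]

/-- The boundary values of `ceIndex` extend the recursion to exponent `-1`: two halves make `M(1,1)
= c`, and the corner value 0 removes the `e²` term there. -/
theorem evalCE_ceIndex : ∀ i j : ℕ,
    evalCE (ceIndex (i + 1) (j + 1)) = mixing (c ^ i) (c ^ j)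
  | 0, 0 => by
    rw [evalCE_ceIndex_succ_succ, ceIndex, ceIndex, ceIndex, evalCE_half_smul_c_pow, map_zero,
      pow_zero, mixing_one_one, mul_zero, sub_zero, mul_add, mul_smul_comm, mul_one]
    module
  | 0, j + 1 => by
    rw [evalCE_ceIndex_succ_succ, evalCE_ceIndex 0 j, ceIndex, ceIndex, evalCE_half_smul_c_pow,
      evalCE_half_smul_c_pow, pow_zero, eq_half_smul (two_mul_mixing_one_pow_succ j)]
    simp only [two_mul, mul_add, mul_smul_comm]
    module
  | i + 1, 0 => by
    rw [evalCE_ceIndex_succ_succ, evalCE_ceIndex i 0, ceIndex, ceIndex, evalCE_half_smul_c_pow,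
      evalCE_half_smul_c_pow, pow_zero, eq_half_smul (two_mul_mixing_pow_succ_one i)]
    simp only [two_mul, mul_add, mul_smul_comm]
    module
  | i + 1, j + 1 => by
    rw [evalCE_ceIndex_succ_succ, evalCE_ceIndex i j, evalCE_ceIndex i (j + 1),
      evalCE_ceIndex (i + 1) j, mixing_pow_succ_succ]

/-! ### Coefficients of the `ce`-index -/

/-- The number of factors `e²` of a `ce`-word. -/
def eCount : List CE → ℕ
  | [] => 0
  | CE.c :: w => eCount w
  | CE.e2 :: w => eCount w + 1

/-- The degree of a `ce`-word in `a` and `b`. -/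
def ceDegree : List CE → ℕ
  | [] => 0
  | CE.c :: w => ceDegree w + 1
  | CE.e2 :: w => ceDegree w + 2

theorem two_mul_eCount_le : ∀ w : List CE, 2 * eCount w ≤ ceDegree w
  | [] => le_rfl
  | CE.c :: w => (two_mul_eCount_le w).trans (Nat.le_succ _)
  | CE.e2 :: w => by
    have := two_mul_eCount_le w
    simp only [eCount, ceDegree]
    omega

theorem coeff_letter_mul_nil {X : Type} (x : X) (p : NCPoly X) :
    (word [x] * p).coeff (FreeMonoid.ofList []) = 0 := by
  refine MonoidAlgebra.coeff_single_mul_of_forall_mul_ne _ _ fun w h => ?_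
  exact absurd (congrArg FreeMonoid.toList h) (List.cons_ne_nil x (FreeMonoid.toList w))

theorem coeff_letter_mul_cons_self {X : Type} (x : X) (p : NCPoly X) (w : List X) :
    (word [x] * p).coeff (FreeMonoid.ofList (x :: w)) = p.coeff (FreeMonoid.ofList w) := by
  rw [word, MonoidAlgebra.of_apply, MonoidAlgebra.coeff_single_mul_eq_mul_coeff, one_mul]
  intro m _
  rw [FreeMonoid.ofList_cons]
  exact mul_right_inj _

theorem coeff_letter_mul_cons_ne {X : Type} {x y : X} (h : x ≠ y) (p : NCPoly X) (w : List X) :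
    (word [x] * p).coeff (FreeMonoid.ofList (y :: w)) = 0 := by
  refine MonoidAlgebra.coeff_single_mul_of_forall_mul_ne _ _ fun m hm => h ?_
  exact (List.cons.inj (congrArg FreeMonoid.toList hm)).1

theorem coeff_c_pow (n : ℕ) (w : List CE) :
    ((word [CE.c]) ^ n).coeff (FreeMonoid.ofList w) =
      if ceDegree w = n ∧ eCount w = 0 then 1 else 0 := by
  induction n generalizing w with
  | zero =>
    rw [pow_zero, MonoidAlgebra.one_def, MonoidAlgebra.coeff_single]
    match w with
    | [] => exact Finsupp.single_eq_same
    | CE.c :: w =>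
      rw [if_neg (by simp [ceDegree])]
      exact Finsupp.single_eq_of_ne (List.cons_ne_nil _ _)
    | CE.e2 :: w =>
      rw [if_neg (by simp [ceDegree])]
      exact Finsupp.single_eq_of_ne (List.cons_ne_nil _ _)
  | succ n ih =>
    rw [pow_succ']
    match w with
    | [] => rw [coeff_letter_mul_nil]; simp [ceDegree]
    | CE.c :: w => rw [coeff_letter_mul_cons_self, ih]; simp [ceDegree, eCount]
    | CE.e2 :: w => rw [coeff_letter_mul_cons_ne (by simp)]; simp [eCount]

/-- The coefficient in `ceIndex i j` of the words with `r` factors `e²`. -/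
def ceCoeff (i j r : ℕ) : ℚ :=
  (-1) ^ r / 2 * if r ≤ i then ((i + j - 2 * r).choose (i - r) : ℚ) else 0

theorem ceCoeff_succ_succ {i j r : ℕ} (h : 2 * r ≤ i + j + 1) :
    ceCoeff (i + 1) (j + 1) r = ceCoeff i (j + 1) r + ceCoeff (i + 1) j r := by
  unfold ceCoeff
  -- Pascal's rule proper needs `r ≤ i`; at `r = i + 1` it degenerates to `1 = 0 + 1`, and beyond
  -- that all terms vanish.
  obtain hr | rfl | hr : r ≤ i ∨ r = i + 1 ∨ i + 1 < r := by omega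
  · obtain ⟨k, rfl⟩ := Nat.exists_eq_add_of_le hr
    rw [if_pos (by omega), if_pos (by omega), if_pos (by omega),
      show r + k + 1 + (j + 1) - 2 * r = (r + k + (j + 1) - 2 * r) + 1 by omega,
      show r + k + 1 - r = k + 1 by omega, Nat.choose_succ_succ,
      show r + k - r = k by omega, show r + k + 1 + j - 2 * r = r + k + (j + 1) - 2 * r by omega]
    push_cast
    ring
  · simp
  · rw [if_neg (by omega), if_neg (by omega), if_neg (by omega)]
    ring

theorem ceCoeff_succ_succ_succ (i j r : ℕ) :
    ceCoeff (i + 1) (j + 1) (r + 1) = -ceCoeff i j r := by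
  unfold ceCoeff
  rw [show i + 1 + (j + 1) - 2 * (r + 1) = i + j - 2 * r by omega, Nat.add_sub_add_right,
    pow_succ]
  simp only [Nat.add_le_add_iff_right]
  ring

theorem coeff_ceIndex : ∀ (i j : ℕ) (w : List CE),
    (ceIndex i j).coeff (FreeMonoid.ofList w) =
      if ceDegree w + 1 = i + j then ceCoeff i j (eCount w) else 0
  | 0, 0, w => by simp [ceIndex]
  | 0, j + 1, w => by
    rw [ceIndex, MonoidAlgebra.coeff_smul_apply, coeff_c_pow]
    by_cases h : ceDegree w = j <;> by_cases h' : eCount w = 0 <;> simp [h, h', ceCoeff]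
  | i + 1, 0, w => by
    have hw := two_mul_eCount_le w
    rw [ceIndex, MonoidAlgebra.coeff_smul_apply, coeff_c_pow]
    by_cases h : ceDegree w = i
    · by_cases h' : eCount w = 0
      · simp [h, h', ceCoeff]
      -- With `r > 0` factors `e²`, the upper index `i + 1 - 2r` is below the lower index `i + 1 -
      -- r`; `2r ≤ i` keeps the subtractions exact.
      · rw [if_neg (by simp [h']), if_pos (by omega), ceCoeff,
          Nat.choose_eq_zero_of_lt (by omega)]
        simp
    · simp [h]
  | i + 1, j + 1, [] => by
    rw [ceIndex, MonoidAlgebra.coeff_sub, Finsupp.sub_apply, coeff_letter_mul_nil,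
      coeff_letter_mul_nil, if_neg (by simp only [ceDegree]; omega), sub_zero]
  | i + 1, j + 1, CE.c :: w => by
    have hw := two_mul_eCount_le w
    rw [ceIndex, MonoidAlgebra.coeff_sub, Finsupp.sub_apply, coeff_letter_mul_cons_self,
      coeff_letter_mul_cons_ne (by simp), sub_zero, MonoidAlgebra.coeff_add, Finsupp.add_apply,
      coeff_ceIndex i (j + 1) w, coeff_ceIndex (i + 1) j w]
    rw [ceDegree, eCount]
    by_cases h : ceDegree w = i + j
    · rw [if_pos (by omega), if_pos (by omega), if_pos (by omega), ceCoeff_succ_succ (by omega)]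
    · rw [if_neg (by omega), if_neg (by omega), if_neg (by omega), add_zero]
  | i + 1, j + 1, CE.e2 :: w => by
    rw [ceIndex, MonoidAlgebra.coeff_sub, Finsupp.sub_apply, coeff_letter_mul_cons_self,
      coeff_letter_mul_cons_ne (by simp), zero_sub, coeff_ceIndex i j w]
    rw [ceDegree, eCount]
    rw [ceCoeff_succ_succ_succ]
    by_cases h : ceDegree w + 1 = i + j
    · rw [if_pos h, if_pos (by omega)]
    · rw [if_neg h, if_neg (by omega), neg_zero]

/-! ### Degree and number of `e²` factors of the words in the theorem -/

theorem ceDegree_append : ∀ u v : List CE, ceDegree (u ++ v) = ceDegree u + ceDegree v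
  | [], v => (Nat.zero_add _).symm
  | CE.c :: u, v => by rw [List.cons_append, ceDegree, ceDegree, ceDegree_append u v]; omega
  | CE.e2 :: u, v => by rw [List.cons_append, ceDegree, ceDegree, ceDegree_append u v]; omega

theorem eCount_append : ∀ u v : List CE, eCount (u ++ v) = eCount u + eCount v
  | [], v => (Nat.zero_add _).symm
  | CE.c :: u, v => by rw [List.cons_append, eCount, eCount, eCount_append u v]
  | CE.e2 :: u, v => by rw [List.cons_append, eCount, eCount, eCount_append u v]; omega

/-- `ceDegree` as a monoid homomorphism. -/
def ceDegreeHom : FreeMonoid CE →* Multiplicative ℕ where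
  toFun w := .ofAdd (ceDegree (FreeMonoid.toList w))
  map_one' := rfl
  map_mul' u v := congrArg Multiplicative.ofAdd (ceDegree_append u.toList v.toList)

/-- `eCount` as a monoid homomorphism. -/
def eCountHom : FreeMonoid CE →* Multiplicative ℕ where
  toFun w := .ofAdd (eCount (FreeMonoid.toList w))
  map_one' := rfl
  map_mul' u v := congrArg Multiplicative.ofAdd (eCount_append u.toList v.toList)

/-- The value of a monoid homomorphism to `ℕ` on `ceWord`. -/
theorem toAdd_hom_ceWord (f : FreeMonoid CE →* Multiplicative ℕ) (r : ℕ) (k : Fin (r + 1) → ℕ) :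
    (f (ceWord r k)).toAdd =
      (∑ t, k t) * (f (FreeMonoid.of CE.c)).toAdd + r * (f (FreeMonoid.of CE.e2)).toAdd := by
  rw [ceWord, map_mul, map_pow, map_list_prod, List.map_ofFn, List.prod_ofFn]
  simp only [Function.comp_apply, map_mul, map_pow, toAdd_mul, toAdd_pow, toAdd_prod,
    Finset.sum_add_distrib, Finset.sum_const, Finset.card_univ, Fintype.card_fin, smul_eq_mul,
    Fin.sum_univ_succ k, ← Finset.sum_mul]
  ring

theorem ceDegree_ceWord (r : ℕ) (k : Fin (r + 1) → ℕ) :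
    ceDegree (ceWord r k).toList = (∑ t, k t) + 2 * r := by
  have h := toAdd_hom_ceWord ceDegreeHom r k
  have hc : (ceDegreeHom (FreeMonoid.of CE.c)).toAdd = 1 := rfl
  have he : (ceDegreeHom (FreeMonoid.of CE.e2)).toAdd = 2 := rfl
  rw [hc, he, mul_one, mul_comm r] at h
  exact h

theorem eCount_ceWord (r : ℕ) (k : Fin (r + 1) → ℕ) : eCount (ceWord r k).toList = r := by
  have h := toAdd_hom_ceWord eCountHom r k
  have hc : (eCountHom (FreeMonoid.of CE.c)).toAdd = 0 := rfl
  have he : (eCountHom (FreeMonoid.of CE.e2)).toAdd = 1 := rfl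
  rw [hc, he, mul_zero, zero_add, mul_one] at h
  exact h

theorem ceCoeff_eq_binom (i j r : ℕ) :
    ceCoeff (i + 1) (j + 1) r =
      (-1 : ℚ) ^ r / 2 * (binom (i + j + 2 - 2 * r) ((i : ℤ) + 1 - r) : ℚ) := by
  rw [ceCoeff, binom, show i + 1 + (j + 1) = i + j + 2 by ring]
  by_cases h : r ≤ i + 1
  · rw [if_pos h, if_pos (by omega), show ((i : ℤ) + 1 - r).toNat = i + 1 - r by omega]
  · rw [if_neg h, if_neg (by omega), Nat.cast_zero]

end MixingCE

theorem mainTheorem10 (i j : ℕ) :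
    (∃! p : MixingCE.NCPoly MixingCE.CE,
      MixingCE.evalCE p = MixingCE.mixing (MixingCE.c ^ i) (MixingCE.c ^ j)) ∧
    ∀ p : MixingCE.NCPoly MixingCE.CE,
      MixingCE.evalCE p = MixingCE.mixing (MixingCE.c ^ i) (MixingCE.c ^ j) →
      ∀ (r : ℕ) (k : Fin (r + 1) → ℕ),
        p.coeff (MixingCE.ceWord r k) =
          if (∑ t, k t) + 2 * r = i + j + 1 then
            (-1 : ℚ) ^ r / 2 * (MixingCE.binom (i + j + 2 - 2 * r) ((i : ℤ) + 1 - r) : ℚ)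
          else 0 := by
  have hq := MixingCE.evalCE_ceIndex i j
  have huniq : ∀ p, MixingCE.evalCE p = MixingCE.mixing (MixingCE.c ^ i) (MixingCE.c ^ j) →
      p = MixingCE.ceIndex (i + 1) (j + 1) := fun p hp =>
    MixingCE.evalCE_injective (hp.trans hq.symm)
  refine ⟨⟨_, hq, huniq⟩, fun p hp r k => ?_⟩
  have h := MixingCE.coeff_ceIndex (i + 1) (j + 1) (MixingCE.ceWord r k).toList
  rw [FreeMonoid.ofList_toList, MixingCE.ceDegree_ceWord, MixingCE.eCount_ceWord,
    MixingCE.ceCoeff_eq_binom] at h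
  rw [huniq p hp, h]
  exact if_congr (by omega) rfl rfl
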